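/- **Lemma 2.1 (Covering Lemma).** Let $\mathbf M$ be a compact (smooth, without boundary) Riemannian manifold of dimension $d$, let $B(x,\rho)$ denote the open ball of center $x$ and radius $\rho$ for the Riemannian distance, $|B(x,\rho)|$ its Riemannian volume, and let $r$ be the injectivity radius of $\mathbf M$. There exist constants $a_1,a_2,c>0$ such that $$a_1\rho^d\le |B(x,\rho)|\le a_2\rho^d\qquad\text{for all } x\in\mathbf M,\ 0<\rho<r, \tag{1}$$ $$|B(x,\lambda)|\le \left(\frac{\lambda}{\sigma}\right)^d c\,|B(x,\sigma)|\qquad\text{for all } x\in\mathbf M,\ 0<\sigma<\lambda<\frac r2. \tag{2}$$ Moreover, for any constants $a_1,a_2,c>0$ satisfying (1) and (2), and for every $0<\rho<r/6$, there is a finite set of points $\{x_i\}\subset\mathbf M$ such that 1. the balls $B(x_i,\rho/4)$ are pairwise disjoint; 2. the balls $B(x_i,\rho/2)$ form a cover of $\mathbf M$; 3. the multiplicity of the cover by the balls $B(x_i,\rho)$, i.e. the largest number of these balls that have a common point, is not greater than $N_{\mathbf M}=12^d c\,a_2/a_1$. (Here $r=\inf_x r_x$, where $r_x$ is the supremum of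 all $R$ such that $\exp_x$ is a diffeomorphism from the ball of radius $R$ about $0$ in the tangent space at $x$ onto $B(x,R)$. $\mathbf M$ need not be connected; points of different components have distance $\infty$.) -/

import Mathlib

open Set Filter MeasureTheory Bundle
open scoped Manifold ContDiff ENNReal NNReal Topology

/-! Throughout, `M` is a `C^∞` manifold of dimension `d` without boundary (modelled on
`EuclideanSpace ℝ (Fin d)`), with a Riemannian metric on its tangent spaces. -/

namespace Riem

noncomputable section

/-- The coordinate expression of the Riemannian metric in the preferred chart `φ` at `p`:
the inner product, at the point `φ⁻¹ y`, of the tangent vectors `D(φ⁻¹)_y u` and `D(φ⁻¹)_y v`. -/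
def metricInChart {d : ℕ} {M : Type*} [TopologicalSpace M]
    [ChartedSpace (EuclideanSpace ℝ (Fin d)) M]
    [RiemannianBundle (fun x : M => TangentSpace (𝓡 d) x)]
    (p : M) (y u v : EuclideanSpace ℝ (Fin d)) : ℝ :=
  inner ℝ
    (mfderiv 𝓘(ℝ, EuclideanSpace ℝ (Fin d)) (𝓡 d) (extChartAt (𝓡 d) p).symm y u)
    (mfderiv 𝓘(ℝ, EuclideanSpace ℝ (Fin d)) (𝓡 d) (extChartAt (𝓡 d) p).symm y v)

/-- The matrix `(g_ij)` of the metric in the preferred chart at `p`, at the coordinate point `y`. -/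
def gramMatrix {d : ℕ} {M : Type*} [TopologicalSpace M]
    [ChartedSpace (EuclideanSpace ℝ (Fin d)) M]
    [RiemannianBundle (fun x : M => TangentSpace (𝓡 d) x)]
    (p : M) (y : EuclideanSpace ℝ (Fin d)) : Matrix (Fin d) (Fin d) ℝ :=
  Matrix.of fun i j =>
    metricInChart p y (EuclideanSpace.single i 1) (EuclideanSpace.single j 1)

/-- The Riemannian volume of the domain `U` of the preferred chart `φ` at `p`, as a measure on `M`:
the measure of a Borel set `A` is the integral of `√det (g_ij)` over `φ (A ∩ U)`. -/
def chartVolume {d : ℕ} {M : Type*} [TopologicalSpace M]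
    [ChartedSpace (EuclideanSpace ℝ (Fin d)) M]
    [RiemannianBundle (fun x : M => TangentSpace (𝓡 d) x)] [MeasurableSpace M]
    (p : M) : Measure M :=
  Measure.map (extChartAt (𝓡 d) p).symm
    ((volume.restrict (extChartAt (𝓡 d) p).target).withDensity
      fun y => ENNReal.ofReal (Real.sqrt (gramMatrix p y).det))

/-- The Riemannian volume measure. By the change of variables formula the measures
`chartVolume p` agree on the overlaps of the chart domains; the volume measure is the measure that
restricts to `chartVolume p` on the domain of the preferred chart at `p`, for every `p`. It is
obtained as the least measure above all of them (the supremum is the one in the complete lattice of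
measures, where `μ ≤ ν` means `μ A ≤ ν A` for all `A`). -/
def volumeMeasure (d : ℕ) (M : Type*) [TopologicalSpace M]
    [ChartedSpace (EuclideanSpace ℝ (Fin d)) M]
    [RiemannianBundle (fun x : M => TangentSpace (𝓡 d) x)] [MeasurableSpace M] : Measure M :=
  ⨆ p : M, chartVolume (d := d) p

/-- The Christoffel symbol of the first kind, as a trilinear form in the chart at `p`:
`Γ(u, v; w) = (∂_u g(v, w) + ∂_v g(u, w) - ∂_w g(u, v)) / 2`. -/
def christoffel {d : ℕ} {M : Type*} [TopologicalSpace M]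
    [ChartedSpace (EuclideanSpace ℝ (Fin d)) M]
    [RiemannianBundle (fun x : M => TangentSpace (𝓡 d) x)]
    (p : M) (y u v w : EuclideanSpace ℝ (Fin d)) : ℝ :=
  (fderiv ℝ (fun z => metricInChart p z v w) y u
    + fderiv ℝ (fun z => metricInChart p z u w) y v
    - fderiv ℝ (fun z => metricInChart p z u v) y w) / 2

/-- `γ : ℝ → M` is a (complete) geodesic: it is smooth and satisfies the geodesic equation
`c'' + Γ(c', c') = 0`. The equation at time `t` is written for the coordinate expression `c` of
`γ` in the preferred chart at `γ t`, with the index lowered, i.e. after taking the inner product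
with an arbitrary vector `w`. -/
def IsGeodesic {d : ℕ} {M : Type*} [TopologicalSpace M]
    [ChartedSpace (EuclideanSpace ℝ (Fin d)) M]
    [RiemannianBundle (fun x : M => TangentSpace (𝓡 d) x)] (γ : ℝ → M) : Prop :=
  ContMDiff 𝓘(ℝ, ℝ) (𝓡 d) ∞ γ ∧
  ∀ (t : ℝ) (w : EuclideanSpace ℝ (Fin d)),
    let c : ℝ → EuclideanSpace ℝ (Fin d) := fun s => extChartAt (𝓡 d) (γ t) (γ s)
    metricInChart (γ t) (c t) (deriv (deriv c) t) w
      + christoffel (γ t) (c t) (deriv c t) (deriv c t) w = 0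

/-- `γ` is the geodesic with `γ 0 = x` and `γ' 0 = v` (an equality in the tangent bundle). -/
def IsGeodesicFrom {d : ℕ} {M : Type*} [TopologicalSpace M]
    [ChartedSpace (EuclideanSpace ℝ (Fin d)) M]
    [RiemannianBundle (fun x : M => TangentSpace (𝓡 d) x)]
    (x : M) (v : TangentSpace (𝓡 d) x) (γ : ℝ → M) : Prop :=
  IsGeodesic (d := d) γ ∧
  (⟨γ 0, mfderiv 𝓘(ℝ, ℝ) (𝓡 d) γ 0 (1 : ℝ)⟩ : TangentBundle (𝓡 d) M) = ⟨x, v⟩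

open Classical in
/-- The exponential map `exp_x v = γ 1`, where `γ` is the geodesic with `γ 0 = x` and `γ' 0 = v`.
On a complete, in particular on a compact, Riemannian manifold such a `γ` exists and is unique. -/
def expMap {d : ℕ} {M : Type*} [TopologicalSpace M]
    [ChartedSpace (EuclideanSpace ℝ (Fin d)) M]
    [RiemannianBundle (fun x : M => TangentSpace (𝓡 d) x)]
    (x : M) (v : TangentSpace (𝓡 d) x) : M :=
  if h : ∃ γ : ℝ → M, IsGeodesicFrom x v γ then h.choose 1 else x

/-- The exponential map at `x` is a diffeomorphism from the open ball of radius `R` about `0` in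
the tangent space at `x` (with the norm given by the metric) onto the open ball `B(x, R)` of `M`. -/
def IsExpDiffeo {d : ℕ} {M : Type*} [EMetricSpace M]
    [ChartedSpace (EuclideanSpace ℝ (Fin d)) M]
    [RiemannianBundle (fun x : M => TangentSpace (𝓡 d) x)]
    (x : M) (R : ℝ≥0∞) : Prop :=
  ∃ Φ : PartialDiffeomorph 𝓘(ℝ, TangentSpace (𝓡 d) x) (𝓡 d) (TangentSpace (𝓡 d) x) M ∞,
    Φ.source = {v | ‖v‖ₑ < R} ∧ Φ.target = Metric.eball x R ∧
      ∀ v ∈ Φ.source, Φ v = expMap x v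

/-- The injectivity radius at `x`: the supremum of all `R` such that `exp_x` is a diffeomorphism
from the ball of radius `R` about `0` onto `B(x, R)`. -/
def injRadiusAt {d : ℕ} {M : Type*} [EMetricSpace M]
    [ChartedSpace (EuclideanSpace ℝ (Fin d)) M]
    [RiemannianBundle (fun x : M => TangentSpace (𝓡 d) x)] (x : M) : ℝ≥0∞ :=
  sSup {R : ℝ≥0∞ | IsExpDiffeo (d := d) x R}

/-- The injectivity radius of `M`. -/
def injRadius (d : ℕ) (M : Type*) [EMetricSpace M]
    [ChartedSpace (EuclideanSpace ℝ (Fin d)) M]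
    [RiemannianBundle (fun x : M => TangentSpace (𝓡 d) x)] : ℝ≥0∞ :=
  ⨅ x : M, injRadiusAt (d := d) x

/-- The open ball `B(x, ρ)` of the Riemannian distance, with a real radius. -/
def ball {M : Type*} [EMetricSpace M] (x : M) (ρ : ℝ) : Set M :=
  Metric.eball x (ENNReal.ofReal ρ)

/-- `a₁` and `a₂` are constants in the two-sided volume bound
`a₁ ρ^d ≤ |B(x, ρ)| ≤ a₂ ρ^d` for all `x` and all `ρ` below the injectivity radius. -/
def IsVolumeBound (d : ℕ) (M : Type*) [EMetricSpace M]
    [ChartedSpace (EuclideanSpace ℝ (Fin d)) M]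
    [RiemannianBundle (fun x : M => TangentSpace (𝓡 d) x)] [MeasurableSpace M]
    (a₁ a₂ : ℝ) : Prop :=
  0 < a₁ ∧ 0 < a₂ ∧ ∀ (x : M) (ρ : ℝ), 0 < ρ → ENNReal.ofReal ρ < injRadius d M →
    ENNReal.ofReal (a₁ * ρ ^ d) ≤ volumeMeasure d M (ball x ρ) ∧
    volumeMeasure d M (ball x ρ) ≤ ENNReal.ofReal (a₂ * ρ ^ d)

/-- `c` is a constant in the doubling inequality `|B(x, l)| ≤ (l / σ)^d c |B(x, σ)|` for all `x`
and all `0 < σ < l` with `l` below half the injectivity radius. -/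
def IsDoublingConstant (d : ℕ) (M : Type*) [EMetricSpace M]
    [ChartedSpace (EuclideanSpace ℝ (Fin d)) M]
    [RiemannianBundle (fun x : M => TangentSpace (𝓡 d) x)] [MeasurableSpace M]
    (c : ℝ) : Prop :=
  0 < c ∧ ∀ (x : M) (σ l : ℝ), 0 < σ → σ < l → ENNReal.ofReal l < injRadius d M / 2 →
    volumeMeasure d M (ball x l) ≤
      ENNReal.ofReal ((l / σ) ^ d * c) * volumeMeasure d M (ball x σ)

/-- The multiplicity of a family of sets: the largest number (possibly `∞`) of members of the
family that contain a common point. -/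
def multiplicity {ι M : Type*} (U : ι → Set M) : ℕ∞ :=
  ⨆ y : M, {i | y ∈ U i}.encard

end

end Riem

namespace Riem

open Manifold

/-! Near its base point a chart and its inverse have bounded derivatives. Integrating along
coordinate segments and along nearly minimal paths makes the chart bi-Lipschitz there, and the
eigenvalues of the Gram matrix bound √det g above and below. Small balls thus have volume comparable
to ρ^d (`exists_local_volume_bound`), uniformly for ρ ≤ ρ₀ by compactness.

For ρ₀ ≤ ρ < r the volume lies between that of the ball of radius ρ₀ and the finite total volume,
while ρ^d is bounded: for d > 0 and M nonempty the injectivity radius is finite, since a compact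
ball of M cannot be diffeomorphic to an open tangent ball (`injRadiusAt_lt_top`). Nothing else about
the exponential map is needed. This gives (1), and (2) follows with c = a₂/a₁.

For the cover, take a maximal ρ/2-separated set. If y lies in n of the balls B(x_i, ρ), the disjoint
balls B(x_i, ρ/4) lie in B(y, 5ρ/4), so n a₁ (ρ/4)^d ≤ |B(y, 5ρ/4)| ≤ 5^d c a₂ (ρ/4)^d
(`card_mul_le_of_disjoint`). Hence n ≤ 5^d c a₂/a₁, which is stronger than the claim. -/

lemma enorm_le_mul_enorm {F G : Type*} [SeminormedAddCommGroup F] [SeminormedAddCommGroup G]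
    {a : F} {b : G} {C : ℝ≥0} (h : ‖a‖ ≤ C * ‖b‖) : ‖a‖ₑ ≤ C * ‖b‖ₑ := by
  rw [enorm_eq_nnnorm, enorm_eq_nnnorm, ← ENNReal.coe_mul, ENNReal.coe_le_coe, ← NNReal.coe_le_coe]
  exact h

variable {d : ℕ} {M : Type*} [EMetricSpace M]
  [ChartedSpace (EuclideanSpace ℝ (Fin d)) M] [IsManifold (𝓡 d) 1 M]
  [RiemannianBundle (fun x : M => TangentSpace (𝓡 d) x)]

/-! ### Derivative bounds for charts -/

section ChartDerivative

variable [IsContinuousRiemannianBundle (EuclideanSpace ℝ (Fin d))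
    (fun x : M => TangentSpace (𝓡 d) x)]

/-- The derivative of the inverse of a chart is bounded near the base point. -/
lemma eventually_norm_mfderiv_symm_le (p : M) :
    ∃ C : ℝ, 0 < C ∧ ∀ᶠ y in 𝓝 (extChartAt (𝓡 d) p p), ∀ u : EuclideanSpace ℝ (Fin d),
      ‖mfderiv 𝓘(ℝ, EuclideanSpace ℝ (Fin d)) (𝓡 d) (extChartAt (𝓡 d) p).symm y u‖
        ≤ C * ‖u‖ := by
  obtain ⟨C, hC, h⟩ := eventually_norm_mfderivWithin_symm_extChartAt_lt (𝓡 d) p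
  refine ⟨C, hC, ?_⟩
  simp only [modelWithCornersSelf_coe, range_id, mfderivWithin_univ, nhdsWithin_univ] at h
  filter_upwards [h] with y hy u
  let := normedAddCommGroupTangentSpaceVectorSpace (E := EuclideanSpace ℝ (Fin d))
  let := normedSpaceTangentSpaceVectorSpace (E := EuclideanSpace ℝ (Fin d))
  exact ((mfderiv 𝓘(ℝ, EuclideanSpace ℝ (Fin d)) (𝓡 d)
    (extChartAt (𝓡 d) p).symm y).le_opNorm u).trans
    (mul_le_mul_of_nonneg_right hy.le (norm_nonneg _))

/-- The derivative of a chart is bounded near the base point. -/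
lemma eventually_norm_mfderiv_le (p : M) :
    ∃ C : ℝ, 0 < C ∧ ∀ᶠ x in 𝓝 p, ∀ u : TangentSpace (𝓡 d) x,
      @norm (EuclideanSpace ℝ (Fin d)) _
        (mfderiv (𝓡 d) 𝓘(ℝ, EuclideanSpace ℝ (Fin d)) (extChartAt (𝓡 d) p) x u) ≤ C * ‖u‖ := by
  obtain ⟨C, hC, h⟩ := eventually_norm_mfderiv_extChartAt_lt (𝓡 d) p
  refine ⟨C, hC, ?_⟩
  filter_upwards [h] with y hy u
  let := normedAddCommGroupTangentSpaceVectorSpace (E := EuclideanSpace ℝ (Fin d))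
  let := normedSpaceTangentSpaceVectorSpace (E := EuclideanSpace ℝ (Fin d))
  exact ((mfderiv (𝓡 d) 𝓘(ℝ, EuclideanSpace ℝ (Fin d)) (extChartAt (𝓡 d) p) y).le_opNorm u).trans
    (mul_le_mul_of_nonneg_right hy.le (norm_nonneg _))

/-- The derivative of the inverse of a chart is bounded below near the base point. -/
lemma eventually_norm_le_norm_mfderiv_symm (p : M) :
    ∃ C : ℝ, 0 < C ∧ ∀ᶠ y in 𝓝 (extChartAt (𝓡 d) p p), ∀ u : EuclideanSpace ℝ (Fin d),
      ‖u‖ ≤ C *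
        ‖mfderiv 𝓘(ℝ, EuclideanSpace ℝ (Fin d)) (𝓡 d) (extChartAt (𝓡 d) p).symm y u‖ := by
  obtain ⟨C, hC, h⟩ := eventually_norm_mfderiv_le (d := d) p
  refine ⟨C, hC, ?_⟩
  have hc : ContinuousAt (extChartAt (𝓡 d) p).symm (extChartAt (𝓡 d) p p) :=
    continuousAt_extChartAt_symm _
  have h' := hc.eventually (by simpa using h)
  filter_upwards [h', extChartAt_target_mem_nhds (I := 𝓡 d) p] with y hy hyt u
  have key := mfderiv_extChartAt_comp_mfderivWithin_extChartAt_symm (I := 𝓡 d) hyt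
  simp only [modelWithCornersSelf_coe, range_id, mfderivWithin_univ] at key
  have := hy (mfderiv 𝓘(ℝ, EuclideanSpace ℝ (Fin d)) (𝓡 d) (extChartAt (𝓡 d) p).symm y u)
  have e := congr($key u)
  refine le_trans (le_of_eq ?_) this
  exact congrArg (fun v : EuclideanSpace ℝ (Fin d) => ‖v‖) e.symm

end ChartDerivative

/-! ### Charts are locally bi-Lipschitz -/

section Distance

variable [IsContinuousRiemannianBundle (EuclideanSpace ℝ (Fin d))
    (fun x : M => TangentSpace (𝓡 d) x)] [IsRiemannianManifold (𝓡 d) M]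

/-- The inverse of a chart is Lipschitz near the base point. -/
lemma exists_edist_symm_le (p : M) :
    ∃ C : ℝ≥0, 0 < C ∧ ∃ r : ℝ, 0 < r ∧
      Metric.ball (extChartAt (𝓡 d) p p) r ⊆ (extChartAt (𝓡 d) p).target ∧
      ∀ a ∈ Metric.ball (extChartAt (𝓡 d) p p) r, ∀ b ∈ Metric.ball (extChartAt (𝓡 d) p p) r,
        edist ((extChartAt (𝓡 d) p).symm a) ((extChartAt (𝓡 d) p).symm b) ≤ C * edist a b := by
  obtain ⟨C, C_pos, hC⟩ := eventually_norm_mfderiv_symm_le (d := d) p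
  lift C to ℝ≥0 using C_pos.le
  obtain ⟨r, r_pos, hr⟩ := Metric.mem_nhds_iff.1
    (inter_mem (extChartAt_target_mem_nhds (I := 𝓡 d) p) hC)
  refine ⟨C, mod_cast C_pos, r, r_pos, fun y hy => (hr hy).1, fun a ha b hb => ?_⟩
  -- The image of the coordinate segment is a competitor in the infimum defining the distance.
  let η := ContinuousAffineMap.lineMap (R := ℝ) a b
  set γ := (extChartAt (𝓡 d) p).symm ∘ η
  have hη : ∀ t ∈ Icc (0 : ℝ) 1, η t ∈ Metric.ball (extChartAt (𝓡 d) p p) r := by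
    intro t ht
    apply (convex_ball _ _).segment_subset ha hb
    rw [segment_eq_image_lineMap]
    exact ⟨t, ht, rfl⟩
  have hη1 : Icc (0 : ℝ) 1 ⊆ η ⁻¹' (extChartAt (𝓡 d) p).target := fun t ht => (hr (hη t ht)).1
  have η_smooth : CMDiff[Icc 0 1] 1 η := by
    apply ContMDiff.contMDiffOn
    rw [contMDiff_iff_contDiff]
    exact ContinuousAffineMap.contDiff _
  have : edist ((extChartAt (𝓡 d) p).symm a) ((extChartAt (𝓡 d) p).symm b)
      ≤ pathELength (𝓡 d) γ 0 1 := by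
    rw [IsRiemannianManifold.out (I := 𝓡 d)]
    apply riemannianEDist_le_pathELength _ _ _ zero_le_one
    · exact (contMDiffOn_extChartAt_symm p).comp η_smooth hη1
    · simp [γ, η, ContinuousAffineMap.coe_lineMap_eq]
    · simp [γ, η, ContinuousAffineMap.coe_lineMap_eq]
  apply this.trans
  rw [← lintegral_fderiv_lineMap_eq_edist, pathELength_eq_lintegral_mfderivWithin_Icc,
    ← lintegral_const_mul' _ _ ENNReal.coe_ne_top]
  apply setLIntegral_mono' measurableSet_Icc (fun t ht ↦ ?_)
  have : mfderivWithin 𝓘(ℝ, ℝ) (𝓡 d) γ (Icc 0 1) t =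
      (mfderiv 𝓘(ℝ, EuclideanSpace ℝ (Fin d)) (𝓡 d) (extChartAt (𝓡 d) p).symm (η t)) ∘L (mfderivWithin 𝓘(ℝ, ℝ) 𝓘(ℝ, EuclideanSpace ℝ (Fin d)) η (Icc 0 1) t) := by
    apply mfderiv_comp_mfderivWithin
    · have := mdifferentiableWithinAt_extChartAt_symm (I := 𝓡 d) (hη1 ht)
      simpa only [modelWithCornersSelf_coe, range_id, mdifferentiableWithinAt_univ] using this
    · exact η_smooth.mdifferentiableOn one_ne_zero t ht
    · rw [uniqueMDiffWithinAt_iff_uniqueDiffWithinAt]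
      exact uniqueDiffOn_Icc zero_lt_one t ht
  have : mfderivWithin 𝓘(ℝ, ℝ) (𝓡 d) γ (Icc 0 1) t (1 : ℝ) =
      (mfderiv 𝓘(ℝ, EuclideanSpace ℝ (Fin d)) (𝓡 d) (extChartAt (𝓡 d) p).symm (η t)) (mfderivWithin 𝓘(ℝ, ℝ) 𝓘(ℝ, EuclideanSpace ℝ (Fin d)) η (Icc 0 1) t (1 : ℝ)) := congr($this 1)
  refine (congrArg (fun v : TangentSpace (𝓡 d) (γ t) => ‖v‖ₑ) this).trans_le ?_
  have h2 := (hr (hη t ht)).2 (mfderivWithin 𝓘(ℝ, ℝ) 𝓘(ℝ, EuclideanSpace ℝ (Fin d)) η (Icc 0 1) t (1 : ℝ))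
  refine (enorm_le_mul_enorm h2).trans (le_of_eq ?_)
  simp only [mfderivWithin_eq_fderivWithin]
  rfl

/-- A chart is Lipschitz near the base point. -/
lemma exists_edist_extChartAt_le (p : M) :
    ∃ C : ℝ≥0, 0 < C ∧ ∃ δ : ℝ≥0∞, 0 < δ ∧ Metric.eball p δ ⊆ (extChartAt (𝓡 d) p).source ∧
      ∀ x ∈ Metric.eball p δ, ∀ y ∈ Metric.eball p δ,
        edist (extChartAt (𝓡 d) p x) (extChartAt (𝓡 d) p y) ≤ C * edist x y := by
  obtain ⟨C, C_pos, hC⟩ := eventually_norm_mfderiv_le (d := d) p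
  lift C to ℝ≥0 using C_pos.le
  obtain ⟨r, r_pos, hr⟩ := EMetric.mem_nhds_iff.1
    (inter_mem (extChartAt_source_mem_nhds (I := 𝓡 d) p) hC)
  -- A path of length below 2r/3 starting within r/3 of p stays in the ball of radius r, where the
  -- derivative bound holds.
  have hr3 : r / 3 ≤ r := ENNReal.div_le_of_le_mul (le_mul_of_one_le_right' (by norm_num))
  refine ⟨C, mod_cast C_pos, r / 3, ENNReal.div_pos r_pos.ne' (by simp),
    fun y hy => (hr (Metric.eball_subset_eball hr3 hy)).1, fun x hx y hy => ?_⟩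
  have hxy : edist x y < r / 3 + r / 3 := by
    refine (edist_triangle x p y).trans_lt (ENNReal.add_lt_add hx ?_)
    rwa [edist_comm]
  have hxy' : edist x y < ⊤ := lt_top_of_lt hxy
  refine ENNReal.le_of_forall_pos_le_add fun ε hε _ => ?_
  -- The bound s on the path length must serve twice: exceed the distance by at most ε/C, and keep
  -- the path in the ball of radius r.
  obtain ⟨s, hs, hs1, hs2⟩ : ∃ s, edist x y < s ∧ s ≤ edist x y + ε / C ∧ s ≤ r / 3 + r / 3 :=
    ⟨min (edist x y + ε / C) (r / 3 + r / 3), lt_min (ENNReal.lt_add_right hxy'.ne (by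
      simp [hε.ne'])) hxy, min_le_left _ _, min_le_right _ _⟩
  rw [IsRiemannianManifold.out (I := 𝓡 d)] at hs
  obtain ⟨γ, hγx, hγy, γ_smooth, hγ, -⟩ :=
    exists_lt_locally_constant_of_riemannianEDist_lt hs zero_lt_one
  have hmem : ∀ t ∈ Icc (0 : ℝ) 1, γ t ∈ Metric.eball p r := by
    intro t ht
    have h1 : edist x (γ t) < s := by
      rw [IsRiemannianManifold.out (I := 𝓡 d)]
      refine (riemannianEDist_le_pathELength γ_smooth.contMDiffOn hγx rfl ht.1).trans_lt
        (lt_of_le_of_lt (pathELength_mono le_rfl ht.2) hγ)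
    rw [Metric.mem_eball, edist_comm]
    have h2 : edist p x < r / 3 := by rw [edist_comm]; exact hx
    calc edist p (γ t) ≤ edist p x + edist x (γ t) := edist_triangle _ _ _
      _ < r / 3 + (r / 3 + r / 3) := ENNReal.add_lt_add h2 (h1.trans_le hs2)
      _ = r := by rw [← add_assoc, ENNReal.add_thirds]
  let γ' := extChartAt (𝓡 d) p ∘ γ
  have hsrc : ∀ t ∈ Icc (0 : ℝ) 1, γ t ∈ (chartAt (EuclideanSpace ℝ (Fin d)) p).source :=
    fun t ht => by simpa only [extChartAt_source] using (hr (hmem t ht)).1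
  have hC' : CMDiff[Icc 0 1] 1 γ' :=
    contMDiffOn_extChartAt.comp (I' := 𝓡 d)
      (t := (chartAt (EuclideanSpace ℝ (Fin d)) p).source) γ_smooth.contMDiffOn hsrc
  have hx0 : extChartAt (𝓡 d) p x = γ' 0 := by simp only [γ', Function.comp_apply, hγx]
  have hy1 : extChartAt (𝓡 d) p y = γ' 1 := by simp only [γ', Function.comp_apply, hγy]
  calc
    edist (extChartAt (𝓡 d) p x) (extChartAt (𝓡 d) p y) = ‖γ' 1 - γ' 0‖ₑ := by
      rw [edist_comm, edist_eq_enorm_sub, hx0, hy1]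
    _ ≤ ∫⁻ t' in Icc (0 : ℝ) 1, ‖derivWithin γ' (Icc 0 1) t'‖ₑ := by
      apply enorm_sub_le_lintegral_derivWithin_Icc_of_contDiffOn_Icc _ zero_le_one
      rwa [← contMDiffOn_iff_contDiffOn]
    _ = ∫⁻ t' in Icc (0 : ℝ) 1, @enorm (EuclideanSpace ℝ (Fin d)) _ (mfderivWithin 𝓘(ℝ, ℝ) 𝓘(ℝ, EuclideanSpace ℝ (Fin d)) γ' (Icc 0 1) t' (1 : ℝ)) := by
      simp_rw [← fderivWithin_derivWithin, mfderivWithin_eq_fderivWithin]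
      rfl
    _ ≤ ∫⁻ t' in Icc (0 : ℝ) 1, C * ‖mfderivWithin 𝓘(ℝ, ℝ) (𝓡 d) γ (Icc 0 1) t' (1 : ℝ)‖ₑ := by
      apply setLIntegral_mono' measurableSet_Icc (fun t' ht' ↦ ?_)
      have : mfderivWithin 𝓘(ℝ, ℝ) 𝓘(ℝ, EuclideanSpace ℝ (Fin d)) γ' (Icc 0 1) t' =
          (mfderiv (𝓡 d) 𝓘(ℝ, EuclideanSpace ℝ (Fin d)) (extChartAt (𝓡 d) p) (γ t')) ∘L (mfderivWithin 𝓘(ℝ, ℝ) (𝓡 d) γ (Icc 0 1) t') := by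
        apply mfderiv_comp_mfderivWithin
        · exact mdifferentiableAt_extChartAt (hsrc t' ht')
        · exact (γ_smooth.mdifferentiable one_ne_zero).mdifferentiableOn _ ht'
        · rw [uniqueMDiffWithinAt_iff_uniqueDiffWithinAt]
          exact uniqueDiffOn_Icc zero_lt_one _ ht'
      have : mfderivWithin 𝓘(ℝ, ℝ) 𝓘(ℝ, EuclideanSpace ℝ (Fin d)) γ' (Icc 0 1) t' (1 : ℝ) =
          (mfderiv (𝓡 d) 𝓘(ℝ, EuclideanSpace ℝ (Fin d)) (extChartAt (𝓡 d) p) (γ t')) (mfderivWithin 𝓘(ℝ, ℝ) (𝓡 d) γ (Icc 0 1) t' (1 : ℝ)) :=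
        congr($this 1)
      rw [this]
      have h2 := (hr (hmem t' ht')).2 (mfderivWithin 𝓘(ℝ, ℝ) (𝓡 d) γ (Icc 0 1) t' (1 : ℝ))
      exact enorm_le_mul_enorm h2
    _ = C * pathELength (𝓡 d) γ 0 1 := by
      rw [lintegral_const_mul' _ _ ENNReal.coe_ne_top,
          pathELength_eq_lintegral_mfderivWithin_Icc]
      rfl
    _ ≤ C * (edist x y + ε / C) := by
      gcongr
      exact hγ.le.trans hs1
    _ ≤ C * edist x y + ε := by
      rw [mul_add]
      gcongr
      exact ENNReal.mul_div_le

end Distance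

/-! ### Determinants of Gram matrices -/

section GramDeterminant

variable {d : ℕ} {F : Type*} [NormedAddCommGroup F] [InnerProductSpace ℝ F]

/-- The Gram matrix of the images of the standard basis vectors under a linear map. -/
noncomputable def basisGram (L : EuclideanSpace ℝ (Fin d) →ₗ[ℝ] F) : Matrix (Fin d) (Fin d) ℝ :=
  Matrix.gram ℝ fun i => L (EuclideanSpace.single i 1)

lemma sum_smul_single (x : EuclideanSpace ℝ (Fin d)) :
    ∑ i, x i • EuclideanSpace.single i (1 : ℝ) = x := by
  have := (EuclideanSpace.basisFun (Fin d) ℝ).sum_repr x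
  simpa using this

lemma sum_smul_apply_single (L : EuclideanSpace ℝ (Fin d) →ₗ[ℝ] F)
    (x : EuclideanSpace ℝ (Fin d)) :
    ∑ i, x i • L (EuclideanSpace.single i (1 : ℝ)) = L x := by
  conv_rhs => rw [← sum_smul_single x, map_sum]
  simp

lemma isHermitian_basisGram (L : EuclideanSpace ℝ (Fin d) →ₗ[ℝ] F) :
    (basisGram L).IsHermitian := Matrix.isHermitian_gram ℝ _

/-- The quadratic form of the Gram matrix is x ↦ ‖L x‖²; evaluate it at a unit eigenvector. -/
lemma eigenvalues_basisGram (L : EuclideanSpace ℝ (Fin d) →ₗ[ℝ] F) (i : Fin d) :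
    (isHermitian_basisGram L).eigenvalues i =
      ‖L ((isHermitian_basisGram L).eigenvectorBasis i)‖ ^ 2 := by
  rw [Matrix.IsHermitian.eigenvalues_eq]
  simp only [basisGram, Matrix.star_dotProduct_gram_mulVec, sum_smul_apply_single]
  simp

/-- The determinant is the product of d eigenvalues, each at most C². The absolute value appears
because C has no assumed sign. -/
lemma sqrt_det_basisGram_le {L : EuclideanSpace ℝ (Fin d) →ₗ[ℝ] F} {C : ℝ}
    (hL : ∀ u, ‖L u‖ ≤ C * ‖u‖) : √(basisGram L).det ≤ |C| ^ d := by
  apply Real.sqrt_le_iff.2 ⟨by positivity, ?_⟩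
  rw [(isHermitian_basisGram L).det_eq_prod_eigenvalues, ← pow_mul, mul_comm, pow_mul, sq_abs]
  calc _ ≤ ∏ i : Fin d, C ^ 2 := by
        apply Finset.prod_le_prod
        · intro i _
          simp only [eigenvalues_basisGram]
          simp
        · intro i _
          simp only [eigenvalues_basisGram]
          have := hL ((isHermitian_basisGram L).eigenvectorBasis i)
          rw [OrthonormalBasis.norm_eq_one, mul_one] at this
          simpa using pow_le_pow_left₀ (norm_nonneg _) this 2
    _ = (C ^ 2) ^ d := by simp

lemma le_sqrt_det_basisGram {L : EuclideanSpace ℝ (Fin d) →ₗ[ℝ] F} {C : ℝ} (hC : 0 < C)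
    (hL : ∀ u, ‖u‖ ≤ C * ‖L u‖) : C⁻¹ ^ d ≤ √(basisGram L).det := by
  apply Real.le_sqrt_of_sq_le
  rw [(isHermitian_basisGram L).det_eq_prod_eigenvalues, ← pow_mul, mul_comm, pow_mul]
  calc (C⁻¹ ^ 2) ^ d = ∏ i : Fin d, C⁻¹ ^ 2 := by simp
    _ ≤ _ := by
        apply Finset.prod_le_prod
        · intro i _
          positivity
        · intro i _
          simp only [eigenvalues_basisGram]
          have := hL ((isHermitian_basisGram L).eigenvectorBasis i)
          rw [OrthonormalBasis.norm_eq_one] at this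
          have h2 : C⁻¹ ≤ ‖L ((isHermitian_basisGram L).eigenvectorBasis i)‖ := by
            rwa [inv_le_iff_one_le_mul₀' hC]
          simpa using pow_le_pow_left₀ (by positivity) h2 2

/-- If A is the matrix of T in the standard basis and G the Gram matrix of L, that of L ∘ T is Aᵀ G
A. -/
lemma det_basisGram_comp (L : EuclideanSpace ℝ (Fin d) →ₗ[ℝ] F)
    (T : EuclideanSpace ℝ (Fin d) →ₗ[ℝ] EuclideanSpace ℝ (Fin d)) :
    (basisGram (L ∘ₗ T)).det = LinearMap.det T ^ 2 * (basisGram L).det := by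
  set b := (EuclideanSpace.basisFun (Fin d) ℝ).toBasis
  set A := LinearMap.toMatrix b b T
  have hA : ∀ i k, A k i = T (EuclideanSpace.single i 1) k := by
    intro i k
    simp [A, b, LinearMap.toMatrix_apply]
  have : basisGram (L ∘ₗ T) = A.transpose * basisGram L * A := by
    ext i j
    have h := fun i => sum_smul_apply_single L (T (EuclideanSpace.single i 1))
    simp only [basisGram, Matrix.gram_apply, LinearMap.comp_apply, Matrix.mul_apply,
      Matrix.transpose_apply, hA]
    rw [← h i, ← h j]
    simp only [sum_inner, inner_sum, inner_smul_left, inner_smul_right, Finset.sum_mul,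
      Finset.mul_sum]
    refine Finset.sum_congr rfl fun k _ => Finset.sum_congr rfl fun l _ => ?_
    simp
    ring
  rw [this, Matrix.det_mul, Matrix.det_mul, Matrix.det_transpose,
    ← LinearMap.det_toMatrix b T]
  ring

lemma sqrt_det_basisGram_comp (L : EuclideanSpace ℝ (Fin d) →ₗ[ℝ] F)
    (T : EuclideanSpace ℝ (Fin d) →ₗ[ℝ] EuclideanSpace ℝ (Fin d)) :
    √(basisGram (L ∘ₗ T)).det = |LinearMap.det T| * √(basisGram L).det := by
  rw [det_basisGram_comp, Real.sqrt_mul (sq_nonneg _), Real.sqrt_sq_eq_abs]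

end GramDeterminant

/-! ### Chart volumes as integrals -/

section Measurability

variable {d : ℕ} {M : Type*} [TopologicalSpace M]
  [ChartedSpace (EuclideanSpace ℝ (Fin d)) M] [MeasurableSpace M] [BorelSpace M]

lemma measurableSet_preimage_symm (p : M) {A : Set M} (hA : MeasurableSet A) :
    MeasurableSet ((extChartAt (𝓡 d) p).symm ⁻¹' A ∩ (extChartAt (𝓡 d) p).target) := by
  have hc := continuousOn_iff_continuous_domRestrict.1 (continuousOn_extChartAt_symm (I := 𝓡 d) p)
  have := MeasurableSet.subtype_image
    (isOpen_extChartAt_target (I := 𝓡 d) p).measurableSet (hc.measurable hA)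
  convert this using 1
  ext y
  simp [and_comm]

variable [RiemannianBundle (fun x : M => TangentSpace (𝓡 d) x)]

lemma chartVolume_apply (p : M) {A : Set M} (hA : MeasurableSet A) :
    chartVolume (d := d) p A =
      ∫⁻ y in (extChartAt (𝓡 d) p).symm ⁻¹' A ∩ (extChartAt (𝓡 d) p).target,
        ENNReal.ofReal √(gramMatrix p y).det := by
  have ht : MeasurableSet (extChartAt (𝓡 d) p).target :=
    (isOpen_extChartAt_target (I := 𝓡 d) p).measurableSet
  have hm : AEMeasurable (extChartAt (𝓡 d) p).symm
      (volume.restrict (extChartAt (𝓡 d) p).target) :=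
    (continuousOn_extChartAt_symm p).aemeasurable ht
  -- The inverse chart is known to be continuous only on the target, so it is used as an a.e.
  -- measurable map, and `withDensity_apply'` avoids measurability of the full preimage of A.
  rw [chartVolume, Measure.map_apply_of_aemeasurable
    (hm.mono_ac (withDensity_absolutelyContinuous _ _)) hA, withDensity_apply',
    Measure.restrict_restrict' ht]

end Measurability

/-! ### The volume measure in a chart -/

section Volume

variable {d : ℕ} {M : Type*} [EMetricSpace M]
  [ChartedSpace (EuclideanSpace ℝ (Fin d)) M]
  [RiemannianBundle (fun x : M => TangentSpace (𝓡 d) x)]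

/-- The Gram matrix of the images of the standard basis under a linear map from the model space
to the tangent space at `z`. -/
noncomputable def tangentGram (z : M)
    (L : EuclideanSpace ℝ (Fin d) →L[ℝ] EuclideanSpace ℝ (Fin d)) : Matrix (Fin d) (Fin d) ℝ :=
  basisGram (F := TangentSpace (𝓡 d) z) L.toLinearMap

lemma gramMatrix_eq_tangentGram (p : M) (y : EuclideanSpace ℝ (Fin d)) :
    gramMatrix p y = tangentGram ((extChartAt (𝓡 d) p).symm y)
      (mfderiv 𝓘(ℝ, EuclideanSpace ℝ (Fin d)) (𝓡 d) (extChartAt (𝓡 d) p).symm y) := rfl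

lemma sqrt_det_tangentGram_comp (z : M)
    (L T : EuclideanSpace ℝ (Fin d) →L[ℝ] EuclideanSpace ℝ (Fin d)) :
    √(tangentGram z (L ∘L T)).det = |T.det| * √(tangentGram z L).det :=
  sqrt_det_basisGram_comp (F := TangentSpace (𝓡 d) z) L.toLinearMap T.toLinearMap

variable [IsManifold (𝓡 d) 1 M]

/-- The transformation rule of the volume density under a change of charts. -/
lemma sqrt_det_gramMatrix_eq (p q : M) {y : EuclideanSpace ℝ (Fin d)}
    (hy : y ∈ (extChartAt (𝓡 d) q).target)
    (hyp : (extChartAt (𝓡 d) q).symm y ∈ (extChartAt (𝓡 d) p).source) :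
    ∃ T : EuclideanSpace ℝ (Fin d) →L[ℝ] EuclideanSpace ℝ (Fin d),
      HasFDerivAt (extChartAt (𝓡 d) p ∘ (extChartAt (𝓡 d) q).symm) T y ∧
      √(gramMatrix q y).det =
        |T.det| * √(gramMatrix p (extChartAt (𝓡 d) p ((extChartAt (𝓡 d) q).symm y))).det := by
  set x := (extChartAt (𝓡 d) q).symm y with hx
  let T : EuclideanSpace ℝ (Fin d) →L[ℝ] EuclideanSpace ℝ (Fin d) :=
    (mfderiv (𝓡 d) 𝓘(ℝ, EuclideanSpace ℝ (Fin d)) (extChartAt (𝓡 d) p) x) ∘L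
      (mfderiv 𝓘(ℝ, EuclideanSpace ℝ (Fin d)) (𝓡 d) (extChartAt (𝓡 d) q).symm y)
  have hd1 : MDifferentiableAt 𝓘(ℝ, EuclideanSpace ℝ (Fin d)) (𝓡 d)
      (extChartAt (𝓡 d) q).symm y := by
    have := mdifferentiableWithinAt_extChartAt_symm (I := 𝓡 d) hy
    simpa only [modelWithCornersSelf_coe, range_id, mdifferentiableWithinAt_univ] using this
  have hd2 : MDifferentiableAt (𝓡 d) 𝓘(ℝ, EuclideanSpace ℝ (Fin d)) (extChartAt (𝓡 d) p) x :=
    mdifferentiableAt_extChartAt (by simpa only [extChartAt_source] using hyp)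
  refine ⟨T, (hd2.hasMFDerivAt.comp y hd1.hasMFDerivAt).hasFDerivAt, ?_⟩
  rw [gramMatrix_eq_tangentGram, gramMatrix_eq_tangentGram, (extChartAt (𝓡 d) p).left_inv hyp]
  refine Eq.trans ?_ (sqrt_det_tangentGram_comp x _ T)
  rw [← hx]
  -- The derivatives of the chart at p and of its inverse cancel, so D(φ_p⁻¹) ∘ T = D(φ_q⁻¹).
  have key := mfderivWithin_extChartAt_symm_comp_mfderiv_extChartAt' (I := 𝓡 d) hyp
  simp only [modelWithCornersSelf_coe, range_id, mfderivWithin_univ] at key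
  congr 3
  ext1 u
  exact (congr($key (mfderiv 𝓘(ℝ, EuclideanSpace ℝ (Fin d)) (𝓡 d)
    (extChartAt (𝓡 d) q).symm y u))).symm

variable [MeasurableSpace M] [BorelSpace M]

/-- The volume measures of two charts agree on the overlap. -/
lemma chartVolume_le_chartVolume (p q : M) {A : Set M} (hA : MeasurableSet A)
    (hAp : A ⊆ (extChartAt (𝓡 d) p).source) :
    chartVolume (d := d) q A ≤ chartVolume (d := d) p A := by
  rw [chartVolume_apply q hA, chartVolume_apply p hA]
  set S := (extChartAt (𝓡 d) q).symm ⁻¹' A ∩ (extChartAt (𝓡 d) q).target with hS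
  have hSm : MeasurableSet S := measurableSet_preimage_symm q hA
  have hex : ∀ y, ∃ T : EuclideanSpace ℝ (Fin d) →L[ℝ] EuclideanSpace ℝ (Fin d), y ∈ S →
      HasFDerivAt (extChartAt (𝓡 d) p ∘ (extChartAt (𝓡 d) q).symm) T y ∧
      √(gramMatrix q y).det =
        |T.det| * √(gramMatrix p (extChartAt (𝓡 d) p ((extChartAt (𝓡 d) q).symm y))).det := by
    intro y
    by_cases hy : y ∈ S
    · obtain ⟨T, hT⟩ := sqrt_det_gramMatrix_eq p q hy.2 (hAp hy.1)
      exact ⟨T, fun _ => hT⟩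
    · exact ⟨0, fun h => absurd h hy⟩
  choose T hT using hex
  have hinj : InjOn (extChartAt (𝓡 d) p ∘ (extChartAt (𝓡 d) q).symm) S := by
    intro a ha b hb hab
    exact (extChartAt (𝓡 d) q).symm.injOn ha.2 hb.2
      ((extChartAt (𝓡 d) p).injOn (hAp ha.1) (hAp hb.1) hab)
  calc _ = ∫⁻ y in S, ENNReal.ofReal |(T y).det| * ENNReal.ofReal
          √(gramMatrix p ((extChartAt (𝓡 d) p ∘ (extChartAt (𝓡 d) q).symm) y)).det := by
        refine setLIntegral_congr_fun hSm fun y hy => ?_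
        simp only [Function.comp_apply]
        rw [(hT y hy).2, ENNReal.ofReal_mul (abs_nonneg _)]
    _ = ∫⁻ y in (extChartAt (𝓡 d) p ∘ (extChartAt (𝓡 d) q).symm) '' S,
          ENNReal.ofReal √(gramMatrix p y).det :=
        (lintegral_image_eq_lintegral_abs_det_fderiv_mul volume hSm
          (fun y hy => (hT y hy).1.hasFDerivWithinAt) hinj
          (fun y => ENNReal.ofReal √(gramMatrix p y).det)).symm
    -- Only an inequality: the image misses the part of A outside the chart domain at q.
    _ ≤ _ := by
        refine lintegral_mono_set ?_
        rintro _ ⟨y, hy, rfl⟩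
        refine ⟨?_, (extChartAt (𝓡 d) p).map_source (hAp hy.1)⟩
        simpa only [mem_preimage, Function.comp_apply, (extChartAt (𝓡 d) p).left_inv (hAp hy.1)]
          using hy.1

/-- On a chart domain, the Riemannian volume is the volume of the chart. -/
lemma volumeMeasure_eq_chartVolume (p : M) {A : Set M} (hA : MeasurableSet A)
    (hAp : A ⊆ (extChartAt (𝓡 d) p).source) :
    volumeMeasure d M A = chartVolume (d := d) p A := by
  refine le_antisymm ?_ (le_iSup (fun p : M => chartVolume (d := d) p) p A)
  have hs : MeasurableSet (extChartAt (𝓡 d) p).source :=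
    (isOpen_extChartAt_source (I := 𝓡 d) p).measurableSet
  -- The supremum is the least upper bound, so it suffices that the right-hand measure dominates
  -- every chart volume; its second term vanishes on A.
  have hle : volumeMeasure d M ≤
      chartVolume (d := d) p + (volumeMeasure d M).restrict (extChartAt (𝓡 d) p).sourceᶜ := by
    refine iSup_le fun q => Measure.le_iff.2 fun B hB => ?_
    rw [Measure.add_apply, Measure.restrict_apply hB, ← measure_inter_add_sdiff B hs]
    refine add_le_add ?_ ?_
    · exact (chartVolume_le_chartVolume p q (hB.inter hs) inter_subset_right).trans
        (measure_mono inter_subset_left)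
    · exact le_iSup (fun p : M => chartVolume (d := d) p) q _
  refine (hle A).trans_eq ?_
  rw [Measure.add_apply, Measure.restrict_apply hA,
    (disjoint_compl_right_iff_subset.2 hAp).inter_eq, measure_empty, add_zero]

end Volume

/-! ### Balls of real radius -/

section Ball

variable {M : Type*} [EMetricSpace M]

lemma isOpen_ball (x : M) (ρ : ℝ) : IsOpen (ball x ρ) := Metric.isOpen_eball

lemma ball_subset_ball (x : M) {s t : ℝ} (h : s ≤ t) : ball x s ⊆ ball x t :=
  Metric.eball_subset_eball (ENNReal.ofReal_le_ofReal h)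

lemma disjoint_ball_of_le_edist {x y : M} {s : ℝ} (h : ENNReal.ofReal (s + s) ≤ edist x y)
    (hs : 0 ≤ s) : Disjoint (ball x s) (ball y s) := by
  refine Set.disjoint_left.2 fun z hx hy => h.not_gt ?_
  rw [ENNReal.ofReal_add hs hs]
  refine (edist_triangle x z y).trans_lt (ENNReal.add_lt_add ?_ hy)
  rw [edist_comm]
  exact hx

end Ball

/-! ### Volume of small balls -/

section LocalBound

variable {d : ℕ} {M : Type*} [EMetricSpace M]
  [ChartedSpace (EuclideanSpace ℝ (Fin d)) M] [IsManifold (𝓡 d) 1 M]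
  [RiemannianBundle (fun x : M => TangentSpace (𝓡 d) x)]
  [IsContinuousRiemannianBundle (EuclideanSpace ℝ (Fin d))
    (fun x : M => TangentSpace (𝓡 d) x)]

/-- The volume density of a chart is bounded above and below near the base point. -/
lemma eventually_sqrt_det_gramMatrix_mem_Icc (p : M) :
    ∃ m C : ℝ, 0 < m ∧ 0 < C ∧ ∀ᶠ y in 𝓝 (extChartAt (𝓡 d) p p),
      m ≤ √(gramMatrix p y).det ∧ √(gramMatrix p y).det ≤ C := by
  obtain ⟨C₁, h₁, H₁⟩ := eventually_norm_mfderiv_symm_le (d := d) p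
  obtain ⟨C₂, h₂, H₂⟩ := eventually_norm_le_norm_mfderiv_symm (d := d) p
  refine ⟨C₂⁻¹ ^ d, |C₁| ^ d, by positivity, by positivity, ?_⟩
  filter_upwards [H₁, H₂] with y hy₁ hy₂
  let z := (extChartAt (𝓡 d) p).symm y
  let L : EuclideanSpace ℝ (Fin d) →L[ℝ] EuclideanSpace ℝ (Fin d) :=
    mfderiv 𝓘(ℝ, EuclideanSpace ℝ (Fin d)) (𝓡 d) (extChartAt (𝓡 d) p).symm y
  exact ⟨le_sqrt_det_basisGram (F := TangentSpace (𝓡 d) z) (L := L.toLinearMap) h₂ hy₂,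
    sqrt_det_basisGram_le (F := TangentSpace (𝓡 d) z) (L := L.toLinearMap) hy₁⟩

lemma volume_ball_eq (y : EuclideanSpace ℝ (Fin d)) {r : ℝ} (hr : 0 < r) :
    volume (Metric.ball y r) =
      ENNReal.ofReal (r ^ d * (volume (Metric.ball (0 : EuclideanSpace ℝ (Fin d)) 1)).toReal) := by
  rw [Measure.addHaar_ball_of_pos _ _ hr, finrank_euclideanSpace_fin,
    ENNReal.ofReal_mul (by positivity), ENNReal.ofReal_toReal measure_ball_lt_top.ne]

variable [IsRiemannianManifold (𝓡 d) M] [MeasurableSpace M] [BorelSpace M]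

/-- Small balls around points near `p` have volume comparable to `ρ ^ d`. -/
lemma exists_local_volume_bound (p : M) :
    ∃ V ∈ 𝓝 p, ∃ ρ₀ a₁ a₂ : ℝ, 0 < ρ₀ ∧ 0 < a₁ ∧ 0 < a₂ ∧ ∀ x ∈ V, ∀ ρ, 0 < ρ → ρ ≤ ρ₀ →
      ENNReal.ofReal (a₁ * ρ ^ d) ≤ volumeMeasure d M (ball x ρ) ∧
      volumeMeasure d M (ball x ρ) ≤ ENNReal.ofReal (a₂ * ρ ^ d) := by
  obtain ⟨m, K, hm, hK, hmK⟩ := eventually_sqrt_det_gramMatrix_mem_Icc (d := d) p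
  obtain ⟨r₂, hr₂, hr₂'⟩ := Metric.mem_nhds_iff.1 hmK
  obtain ⟨C₁, hC₁, r₁, hr₁, ht, hL₁⟩ := exists_edist_symm_le (d := d) p
  obtain ⟨C₂, hC₂, δ₂, hδ₂, hs, hL₂⟩ := exists_edist_extChartAt_le (d := d) p
  set φ := extChartAt (𝓡 d) p
  set v := (volume (Metric.ball (0 : EuclideanSpace ℝ (Fin d)) 1)).toReal with hv
  have hvpos : 0 < v := ENNReal.toReal_pos (Metric.measure_ball_pos _ _ one_pos).ne'
    measure_ball_lt_top.ne
  obtain ⟨e, he, heδ⟩ := ENNReal.lt_iff_exists_nnreal_btwn.1 hδ₂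
  have he' : (0 : ℝ) < e := mod_cast he
  have hC₁' : (0 : ℝ) < C₁ := mod_cast hC₁
  have hC₂' : (0 : ℝ) < C₂ := mod_cast hC₂
  set r := min r₁ r₂
  have hr0 : 0 < r := lt_min hr₁ hr₂
  -- For x within δ of p and ρ ≤ δ, these keep B(x, ρ) where φ is Lipschitz, its image within r/2 of
  -- φ p, and the coordinate ball of radius ρ/C₁ about φ x within r of φ p.
  obtain ⟨δ, hδ, hδe, hδr, hδC⟩ : ∃ δ : ℝ, 0 < δ ∧ δ + δ ≤ e ∧ C₂ * (δ + δ) ≤ r / 2 ∧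
      δ / C₁ ≤ r / 2 := by
    refine ⟨min (e / 2) (min (r / (4 * C₂)) (C₁ * r / 2)), by positivity, ?_, ?_, ?_⟩
    · linarith [min_le_left ((e : ℝ) / 2) (min (r / (4 * C₂)) (C₁ * r / 2))]
    · have : min ((e : ℝ) / 2) (min (r / (4 * C₂)) (C₁ * r / 2)) ≤ r / (4 * C₂) :=
        (min_le_right _ _).trans (min_le_left _ _)
      rw [le_div_iff₀ (by positivity)] at this
      linarith
    · have : min ((e : ℝ) / 2) (min (r / (4 * C₂)) (C₁ * r / 2)) ≤ C₁ * r / 2 :=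
        (min_le_right _ _).trans (min_le_right _ _)
      rw [div_le_iff₀ hC₁']
      linarith
  have hsub : ∀ {q : M} {s : ℝ}, s ≤ δ + δ → edist q p < ENNReal.ofReal s →
      q ∈ Metric.eball p δ₂ := by
    intro q s hs hq
    refine lt_of_lt_of_le hq (le_trans ?_ heδ.le)
    rw [ENNReal.ofReal_le_iff_le_toReal (by simp)]
    exact hs.trans hδe
  have hlip : ∀ {q q' : M} {s : ℝ}, q ∈ Metric.eball p δ₂ → q' ∈ Metric.eball p δ₂ →
      edist q q' < ENNReal.ofReal s → dist (φ q) (φ q') < C₂ * s := by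
    intro q q' s hq hq' hqq
    rw [← edist_lt_ofReal, ENNReal.ofReal_mul hC₂'.le, ENNReal.ofReal_coe_nnreal]
    exact (hL₂ q hq q' hq').trans_lt
      (ENNReal.mul_lt_mul_right (by simpa using hC₂.ne') (by simp) hqq)
  have hp : p ∈ Metric.eball p δ₂ := Metric.mem_eball_self hδ₂
  -- In coordinates B(x, ρ) contains the ball of radius ρ/C₁ and lies in the one of radius C₂ρ about
  -- φ x; the density is between m and K, and v is the volume of the unit ball.
  refine ⟨Metric.eball p (ENNReal.ofReal δ), Metric.eball_mem_nhds _ (by simpa using hδ), δ,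
    m * v * (C₁ : ℝ)⁻¹ ^ d, K * v * C₂ ^ d, hδ, by positivity, by positivity, ?_⟩
  intro x hx ρ hρ hρδ
  have hx₂ : x ∈ Metric.eball p δ₂ := hsub (by linarith) hx
  have hball : ∀ q ∈ ball x ρ, edist q p < ENNReal.ofReal (δ + δ) := by
    intro q hq
    rw [ENNReal.ofReal_add hδ.le hδ.le]
    exact (edist_triangle q x p).trans_lt
      (ENNReal.add_lt_add (lt_of_lt_of_le hq (ENNReal.ofReal_le_ofReal hρδ)) hx)
  have hball₂ : ∀ q ∈ ball x ρ, q ∈ Metric.eball p δ₂ := fun q hq => hsub le_rfl (hball q hq)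
  have hBm : MeasurableSet (ball x ρ) := (isOpen_ball x ρ).measurableSet
  rw [volumeMeasure_eq_chartVolume p hBm (fun q hq => hs (hball₂ q hq)), chartVolume_apply p hBm]
  constructor
  · have hφx : dist (φ x) (φ p) < r / 2 :=
      (hlip hx₂ hp hx).trans_le (le_trans (by gcongr; linarith) hδr)
    have hin : ∀ y ∈ Metric.ball (φ x) (ρ / C₁), y ∈ Metric.ball (φ p) r := by
      intro y hy
      have h1 : dist y (φ x) < δ / C₁ := lt_of_lt_of_le hy (by gcongr)
      rw [Metric.mem_ball]
      linarith [dist_triangle y (φ x) (φ p)]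
    have hsubset : Metric.ball (φ x) (ρ / C₁) ⊆ φ.symm ⁻¹' ball x ρ ∩ φ.target := by
      intro y hy
      have hyr₁ := Metric.ball_subset_ball (min_le_left r₁ r₂) (hin y hy)
      refine ⟨?_, ht hyr₁⟩
      have hxr₁ : φ x ∈ Metric.ball (φ p) r₁ := by
        rw [Metric.mem_ball]
        linarith [min_le_left r₁ r₂]
      have := hL₁ y hyr₁ (φ x) hxr₁
      rw [φ.left_inv (hs hx₂)] at this
      have hy' : edist y (φ x) < ENNReal.ofReal (ρ / C₁) := edist_lt_ofReal.2 hy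
      calc edist (φ.symm y) x ≤ C₁ * edist y (φ x) := this
        _ < C₁ * ENNReal.ofReal (ρ / C₁) :=
          ENNReal.mul_lt_mul_right (by simpa using hC₁.ne') (by simp) hy'
        _ = ENNReal.ofReal ρ := by
          rw [← ENNReal.ofReal_coe_nnreal, ← ENNReal.ofReal_mul hC₁'.le]
          congr 1
          field_simp
    calc ENNReal.ofReal (m * v * (C₁ : ℝ)⁻¹ ^ d * ρ ^ d)
        = ENNReal.ofReal m * volume (Metric.ball (φ x) (ρ / C₁)) := by
          rw [volume_ball_eq _ (by positivity), ← ENNReal.ofReal_mul hm.le]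
          congr 1
          rw [div_eq_mul_inv, mul_pow, ← hv]
          ring
      _ = ∫⁻ _ in Metric.ball (φ x) (ρ / C₁), ENNReal.ofReal m := by simp
      _ ≤ ∫⁻ y in Metric.ball (φ x) (ρ / C₁), ENNReal.ofReal √(gramMatrix p y).det :=
          setLIntegral_mono' measurableSet_ball fun y hy => ENNReal.ofReal_le_ofReal
            (hr₂' (Metric.ball_subset_ball (min_le_right r₁ r₂) (hin y hy))).1
      _ ≤ _ := lintegral_mono_set hsubset
  · have hsubset : φ.symm ⁻¹' ball x ρ ∩ φ.target ⊆ Metric.ball (φ x) (C₂ * ρ) := by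
      rintro y ⟨hy, hyt⟩
      have := hlip (hball₂ _ hy) hx₂ hy
      rwa [φ.right_inv hyt] at this
    have hin : ∀ y ∈ φ.symm ⁻¹' ball x ρ ∩ φ.target, y ∈ Metric.ball (φ p) r₂ := by
      rintro y ⟨hy, hyt⟩
      have := hlip (hball₂ _ hy) hp (hball _ hy)
      rw [φ.right_inv hyt] at this
      rw [Metric.mem_ball]
      linarith [min_le_right r₁ r₂]
    calc _ ≤ ∫⁻ _ in φ.symm ⁻¹' ball x ρ ∩ φ.target, ENNReal.ofReal K :=
          setLIntegral_mono' (measurableSet_preimage_symm p hBm) fun y hy =>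
            ENNReal.ofReal_le_ofReal (hr₂' (hin y hy)).2
      _ ≤ ∫⁻ _ in Metric.ball (φ x) (C₂ * ρ), ENNReal.ofReal K := lintegral_mono_set hsubset
      _ = ENNReal.ofReal K * volume (Metric.ball (φ x) (C₂ * ρ)) := by simp
      _ = ENNReal.ofReal (K * v * C₂ ^ d * ρ ^ d) := by
          rw [volume_ball_eq _ (by positivity), ← ENNReal.ofReal_mul hK.le]
          congr 1
          rw [mul_pow, ← hv]
          ring

variable [CompactSpace M]

/-- On a compact manifold, small balls have volume uniformly comparable to `ρ ^ d`. -/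
lemma exists_uniform_volume_bound :
    ∃ ρ₀ a₁ a₂ : ℝ, 0 < ρ₀ ∧ 0 < a₁ ∧ 0 < a₂ ∧ ∀ (x : M) (ρ : ℝ), 0 < ρ → ρ ≤ ρ₀ →
      ENNReal.ofReal (a₁ * ρ ^ d) ≤ volumeMeasure d M (ball x ρ) ∧
      volumeMeasure d M (ball x ρ) ≤ ENNReal.ofReal (a₂ * ρ ^ d) := by
  have : ∃ ρ₀ a₁ a₂ : ℝ, 0 < ρ₀ ∧ 0 < a₁ ∧ 0 < a₂ ∧ ∀ x ∈ (univ : Set M), ∀ ρ : ℝ, 0 < ρ →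
      ρ ≤ ρ₀ → ENNReal.ofReal (a₁ * ρ ^ d) ≤ volumeMeasure d M (ball x ρ) ∧
      volumeMeasure d M (ball x ρ) ≤ ENNReal.ofReal (a₂ * ρ ^ d) := by
    refine isCompact_univ.induction_on (p := fun s : Set M => ∃ ρ₀ a₁ a₂ : ℝ, 0 < ρ₀ ∧ 0 < a₁ ∧
      0 < a₂ ∧ ∀ x ∈ s, ∀ ρ : ℝ, 0 < ρ → ρ ≤ ρ₀ →
      ENNReal.ofReal (a₁ * ρ ^ d) ≤ volumeMeasure d M (ball x ρ) ∧
      volumeMeasure d M (ball x ρ) ≤ ENNReal.ofReal (a₂ * ρ ^ d)) ?_ ?_ ?_ ?_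
    · exact ⟨1, 1, 1, one_pos, one_pos, one_pos, by simp⟩
    · rintro s t hst ⟨ρ₀, a₁, a₂, h₀, h₁, h₂, H⟩
      exact ⟨ρ₀, a₁, a₂, h₀, h₁, h₂, fun x hx => H x (hst hx)⟩
    · rintro s t ⟨ρ₀, a₁, a₂, h₀, h₁, h₂, H⟩ ⟨ρ₀', a₁', a₂', h₀', h₁', h₂', H'⟩
      refine ⟨min ρ₀ ρ₀', min a₁ a₁', max a₂ a₂', lt_min h₀ h₀', lt_min h₁ h₁',
        lt_max_of_lt_left h₂, ?_⟩
      rintro x (hx | hx) ρ hρ hρ'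
      · obtain ⟨h, h'⟩ := H x hx ρ hρ (hρ'.trans (min_le_left _ _))
        exact ⟨le_trans (ENNReal.ofReal_le_ofReal (by gcongr; exact min_le_left _ _)) h,
          h'.trans (ENNReal.ofReal_le_ofReal (by gcongr; exact le_max_left _ _))⟩
      · obtain ⟨h, h'⟩ := H' x hx ρ hρ (hρ'.trans (min_le_right _ _))
        exact ⟨le_trans (ENNReal.ofReal_le_ofReal (by gcongr; exact min_le_right _ _)) h,
          h'.trans (ENNReal.ofReal_le_ofReal (by gcongr; exact le_max_right _ _))⟩
    · intro p _
      obtain ⟨V, hV, h⟩ := exists_local_volume_bound (d := d) p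
      exact ⟨V, mem_nhdsWithin_of_mem_nhds hV, h⟩
  simpa using this

/-- Finitely many balls of radius ρ₀, each of finite volume, cover M. -/
lemma volumeMeasure_univ_lt_top : volumeMeasure d M univ < ⊤ := by
  obtain ⟨ρ₀, a₁, a₂, h₀, h₁, h₂, H⟩ := exists_uniform_volume_bound (d := d) (M := M)
  refine isCompact_univ.measure_lt_top_of_nhdsWithin fun x _ => ⟨ball x ρ₀, ?_, ?_⟩
  · exact mem_nhdsWithin_of_mem_nhds (Metric.eball_mem_nhds _ (by simpa using h₀))
  · exact (H x ρ₀ h₀ le_rfl).2.trans_lt ENNReal.ofReal_lt_top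

end LocalBound

/-! ### Finiteness of the injectivity radius -/

section InjectivityRadius

/-- A compact open ball would be clopen, hence the whole connected space, which is not compact. -/
lemma not_isCompact_enorm_lt {F : Type*} [NormedAddCommGroup F] [NormedSpace ℝ F] [Nontrivial F]
    {R : ℝ≥0∞} (hR : 0 < R) : ¬ IsCompact {v : F | ‖v‖ₑ < R} := by
  intro hc
  have ho : IsOpen {v : F | ‖v‖ₑ < R} := isOpen_lt continuous_enorm continuous_const
  have hu : {v : F | ‖v‖ₑ < R} = univ :=
    IsClopen.eq_univ ⟨hc.isClosed, ho⟩ ⟨0, by simpa using hR⟩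
  have := NormedSpace.noncompactSpace ℝ F
  exact noncompact_univ F (hu ▸ hc)

variable {d : ℕ} {M : Type*} [EMetricSpace M] [CompactSpace M]

/-- In a compact space, the points at finite distance from `x` lie in a ball of finite radius. -/
lemma exists_edist_le_of_lt_top (x : M) :
    ∃ D : ℝ≥0∞, D < ⊤ ∧ ∀ y, edist y x < ⊤ → edist y x ≤ D := by
  -- The points at finite distance form a closed set, so the distance attains a maximum there, which
  -- is finite.
  have hc : IsCompact (Metric.eball x ⊤) := Metric.isClosed_eball_top.isCompact
  obtain ⟨y, hy, hmax⟩ := hc.exists_isMaxOn ⟨x, Metric.mem_eball_self ENNReal.zero_lt_top⟩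
    (continuous_id.edist continuous_const : Continuous fun y => edist y x).continuousOn
  exact ⟨edist y x, hy, fun z hz => hmax hz⟩

variable [ChartedSpace (EuclideanSpace ℝ (Fin d)) M]
  [RiemannianBundle (fun x : M => TangentSpace (𝓡 d) x)]

/-- Otherwise some admissible R exceeds all finite distances from x. Then B(x, R) is closed, hence
compact, and so is the tangent ball diffeomorphic to it, which is impossible for d ≠ 0. -/
lemma injRadiusAt_lt_top (hd : d ≠ 0) (x : M) : injRadiusAt (d := d) x < ⊤ := by
  by_contra htop
  rw [not_lt_top_iff] at htop
  obtain ⟨D, hD, hmax⟩ := exists_edist_le_of_lt_top x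
  obtain ⟨R, ⟨Φ, hsrc, htgt, -⟩, hDR⟩ := lt_sSup_iff.1 (htop ▸ hD :
    D < injRadiusAt (d := d) x)
  have hball : Metric.eball x R = Metric.eball x ⊤ := by
    refine subset_antisymm (Metric.eball_subset_eball le_top) fun y hy => ?_
    exact (hmax y hy).trans_lt hDR
  have hc : IsCompact Φ.target := by
    rw [htgt, hball]
    exact Metric.isClosed_eball_top.isCompact
  have hcs : IsCompact Φ.source := by
    rw [← Φ.toPartialEquiv.symm_image_target_eq_source]
    exact hc.image_of_continuousOn Φ.contMDiffOn_invFun.continuousOn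
  rw [hsrc] at hcs
  have : Nonempty (Fin d) := ⟨⟨0, Nat.pos_of_ne_zero hd⟩⟩
  have : Nontrivial (TangentSpace (𝓡 d) x) :=
    inferInstanceAs (Nontrivial (EuclideanSpace ℝ (Fin d)))
  exact not_isCompact_enorm_lt (bot_lt_of_lt hDR) hcs

lemma injRadius_lt_top (hd : d ≠ 0) [Nonempty M] : injRadius d M < ⊤ :=
  (iInf_le _ (Classical.arbitrary M)).trans_lt (injRadiusAt_lt_top hd _)

/-- Keeps the lower volume bound alive for large ρ. For d = 0 no bound on ρ is needed, as ρ^0 = 1;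
the point argument disposes of empty M, where the infimum is ⊤. -/
lemma exists_pow_le_of_lt_injRadius :
    ∃ K : ℝ, 0 < K ∧ ∀ (_ : M) (ρ : ℝ), 0 < ρ → ENNReal.ofReal ρ < injRadius d M →
      ρ ^ d ≤ K ^ d := by
  rcases eq_or_ne d 0 with rfl | hd
  · exact ⟨1, one_pos, by simp⟩
  rcases isEmpty_or_nonempty M with hM | hM
  · exact ⟨1, one_pos, fun x => (hM.false x).elim⟩
  refine ⟨(injRadius d M).toReal + 1, by positivity, fun _ ρ hρ h => ?_⟩
  have : ρ ≤ (injRadius d M).toReal :=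
    ((ENNReal.ofReal_lt_iff_lt_toReal hρ.le (injRadius_lt_top hd).ne).1 h).le
  gcongr
  linarith

end InjectivityRadius

/-! ### Volume bounds up to the injectivity radius -/

section GlobalBound

variable {d : ℕ} {M : Type*} [EMetricSpace M] [CompactSpace M]
  [ChartedSpace (EuclideanSpace ℝ (Fin d)) M] [IsManifold (𝓡 d) 1 M]
  [RiemannianBundle (fun x : M => TangentSpace (𝓡 d) x)]
  [IsContinuousRiemannianBundle (EuclideanSpace ℝ (Fin d))
    (fun x : M => TangentSpace (𝓡 d) x)]
  [IsRiemannianManifold (𝓡 d) M] [MeasurableSpace M] [BorelSpace M]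

lemma exists_isVolumeBound : ∃ a₁ a₂ : ℝ, IsVolumeBound d M a₁ a₂ := by
  obtain ⟨ρ₀, a₁, a₂, h₀, h₁, h₂, H⟩ := exists_uniform_volume_bound (d := d) (M := M)
  obtain ⟨K, hK, hpow⟩ := exists_pow_le_of_lt_injRadius (d := d) (M := M)
  set V := (volumeMeasure d M univ).toReal
  have hV0 : 0 ≤ V := ENNReal.toReal_nonneg
  have hV : ENNReal.ofReal V = volumeMeasure d M univ :=
    ENNReal.ofReal_toReal volumeMeasure_univ_lt_top.ne
  -- The second entries treat ρ ≥ ρ₀: compare with the ball of radius ρ₀, using ρ^d ≤ K^d, and with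
  -- the total volume V, using ρ₀^d ≤ ρ^d.
  refine ⟨min a₁ (a₁ * ρ₀ ^ d / K ^ d), max a₂ (V / ρ₀ ^ d), lt_min h₁ (by positivity),
    lt_max_of_lt_left h₂, fun x ρ hρ hρr => ?_⟩
  rcases le_total ρ ρ₀ with h | h
  · obtain ⟨hl, hu⟩ := H x ρ hρ h
    exact ⟨le_trans (ENNReal.ofReal_le_ofReal (by gcongr; exact min_le_left _ _)) hl,
      hu.trans (ENNReal.ofReal_le_ofReal (by gcongr; exact le_max_left _ _))⟩
  · constructor
    · refine le_trans (ENNReal.ofReal_le_ofReal ?_)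
        ((H x ρ₀ h₀ le_rfl).1.trans (measure_mono (ball_subset_ball x h)))
      calc min a₁ (a₁ * ρ₀ ^ d / K ^ d) * ρ ^ d ≤ (a₁ * ρ₀ ^ d / K ^ d) * K ^ d :=
            mul_le_mul (min_le_right _ _) (hpow x ρ hρ hρr) (by positivity) (by positivity)
        _ = a₁ * ρ₀ ^ d := by field_simp
    · refine (measure_mono (subset_univ _)).trans (hV.symm.trans_le (ENNReal.ofReal_le_ofReal ?_))
      calc V = V / ρ₀ ^ d * ρ₀ ^ d := by field_simp
        _ ≤ max a₂ (V / ρ₀ ^ d) * ρ ^ d := by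
            gcongr
            exact le_max_right _ _

end GlobalBound

/-! ### Maximal separated sets -/

section Packing

variable {M : Type*} [EMetricSpace M] [CompactSpace M]

/-- In a compact space there is a finite maximal `ε`-separated set. -/
lemma exists_finset_separated_cover {ε : ℝ≥0∞} (hε : 0 < ε) :
    ∃ X : Finset M, (∀ x ∈ X, ∀ y ∈ X, x ≠ y → ε ≤ edist x y) ∧
      ⋃ x ∈ X, Metric.eball x ε = univ := by
  obtain ⟨N, -, hN⟩ := zorn_subset_nonempty
    {N : Set M | N.Pairwise fun x y => ε ≤ edist x y} (fun c hc hchain _ => ⟨⋃₀ c,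
      (pairwise_sUnion hchain.directedOn).2 hc, fun s hs => subset_sUnion_of_mem hs⟩) ∅ (by simp)
  have hcov : ⋃ x ∈ N, Metric.eball x ε = univ := by
    refine eq_univ_of_forall fun y => ?_
    by_contra hy
    simp only [mem_iUnion, not_exists, Metric.mem_eball, not_lt] at hy
    -- An uncovered point could be added to N, against maximality.
    have hins : insert y N ∈ {N : Set M | N.Pairwise fun x y => ε ≤ edist x y} :=
      (hN.prop : N.Pairwise _).insert fun b hb _ => ⟨hy b hb, by rw [edist_comm]; exact hy b hb⟩
    have hyN : y ∈ N := hN.le_of_ge hins (subset_insert y N) (mem_insert y N)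
    exact hε.not_ge (by simpa using hy y hyN)
  have hfin : N.Finite := by
    obtain ⟨t, htN, htf, ht⟩ := isCompact_univ.elim_finite_subcover_image (b := N)
      (c := fun x => Metric.eball x ε) (fun _ _ => Metric.isOpen_eball) hcov.ge
    -- By separation, a point of N lies in a ball of the finite subcover only if it is its center.
    refine htf.subset fun x hx => ?_
    obtain ⟨z, hz, hxz⟩ := mem_iUnion₂.1 (ht (mem_univ x))
    by_contra hxt
    have hne : x ≠ z := fun h => hxt (h ▸ hz)
    exact (not_lt.2 ((hN.prop : N.Pairwise _) hx (htN hz) hne)) hxz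
  refine ⟨hfin.toFinset, fun x hx y hy hxy => ?_, by simpa using hcov⟩
  exact (hN.prop : N.Pairwise _) (by simpa using hx) (by simpa using hy) hxy

end Packing

/-! ### Doubling and multiplicity -/

section Multiplicity

variable {d : ℕ} {M : Type*} [EMetricSpace M]
  [ChartedSpace (EuclideanSpace ℝ (Fin d)) M]
  [RiemannianBundle (fun x : M => TangentSpace (𝓡 d) x)] [MeasurableSpace M]

/-- Divide the upper bound at l by the lower bound at σ; both radii are below the injectivity
radius. -/
lemma IsVolumeBound.isDoublingConstant {a₁ a₂ : ℝ} (h : IsVolumeBound d M a₁ a₂) :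
    IsDoublingConstant d M (a₂ / a₁) := by
  obtain ⟨h₁, h₂, H⟩ := h
  refine ⟨by positivity, fun x σ l hσ hσl hl => ?_⟩
  have hl0 : 0 < l := hσ.trans hσl
  have hl' : ENNReal.ofReal l < injRadius d M := hl.trans_le ENNReal.half_le_self
  have hσ' : ENNReal.ofReal σ < injRadius d M :=
    (ENNReal.ofReal_le_ofReal hσl.le).trans_lt hl'
  calc volumeMeasure d M (ball x l) ≤ ENNReal.ofReal (a₂ * l ^ d) := (H x l hl0 hl').2
    _ = ENNReal.ofReal ((l / σ) ^ d * (a₂ / a₁)) * ENNReal.ofReal (a₁ * σ ^ d) := by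
        rw [← ENNReal.ofReal_mul (by positivity)]
        congr 1
        rw [div_pow]
        field_simp
    _ ≤ _ := by
        gcongr
        exact (H x σ hσ hσ').1

variable [BorelSpace M]

/-- Volume comparison: a point lies in boundedly many of the balls of radius `ρ` around centers
whose balls of radius `ρ / 4` are disjoint. -/
lemma card_mul_le_of_disjoint {a₁ a₂ c : ℝ} (hvol : IsVolumeBound d M a₁ a₂)
    (hdbl : IsDoublingConstant d M c) {ρ : ℝ} (hρ : 0 < ρ)
    (hρr : ENNReal.ofReal ρ < injRadius d M / 6) (s : Finset M) (y : M)
    (hdisj : (s : Set M).PairwiseDisjoint fun x => ball x (ρ / 4))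
    (hs : ∀ x ∈ s, y ∈ ball x ρ) : (s.card : ℝ) ≤ 5 ^ d * c * a₂ / a₁ := by
  obtain ⟨h₁, h₂, hv⟩ := hvol
  obtain ⟨hc, hd⟩ := hdbl
  have hr0 : ENNReal.ofReal (6 * ρ) < injRadius d M := by
    rw [ENNReal.lt_div_iff_mul_lt (by simp) (by simp)] at hρr
    rwa [mul_comm, ENNReal.ofReal_mul hρ.le, ENNReal.ofReal_ofNat]
  have hr1 : ENNReal.ofReal (ρ / 4) < injRadius d M :=
    (ENNReal.ofReal_le_ofReal (by linarith)).trans_lt hr0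
  have hr2 : ENNReal.ofReal (ρ + ρ / 4) < injRadius d M / 2 := by
    rw [ENNReal.lt_div_iff_mul_lt (by simp) (by simp), ← ENNReal.ofReal_ofNat,
      ← ENNReal.ofReal_mul (by linarith)]
    exact (ENNReal.ofReal_le_ofReal (by linarith)).trans_lt hr0
  -- The enclosing ball is centered at y, so doubling is applied once, at y, with radius ratio 5.
  have hsub : ⋃ x ∈ s, ball x (ρ / 4) ⊆ ball y (ρ + ρ / 4) := by
    refine iUnion₂_subset fun x hx z hz => ?_
    have hz' : edist z x < ENNReal.ofReal (ρ / 4) := hz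
    have hy' : edist x y < ENNReal.ofReal ρ := by rw [edist_comm]; exact hs x hx
    change edist z y < _
    rw [add_comm, ENNReal.ofReal_add (by linarith) hρ.le]
    exact (edist_triangle z x y).trans_lt (ENNReal.add_lt_add hz' hy')
  have key : ENNReal.ofReal (s.card * (a₁ * (ρ / 4) ^ d)) ≤
      ENNReal.ofReal (5 ^ d * c * (a₂ * (ρ / 4) ^ d)) := by
    calc ENNReal.ofReal (s.card * (a₁ * (ρ / 4) ^ d))
        = ∑ x ∈ s, ENNReal.ofReal (a₁ * (ρ / 4) ^ d) := by
          rw [ENNReal.ofReal_mul (by positivity)]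
          simp
      _ ≤ ∑ x ∈ s, volumeMeasure d M (ball x (ρ / 4)) :=
          Finset.sum_le_sum fun x _ => (hv x _ (by linarith) hr1).1
      _ = volumeMeasure d M (⋃ x ∈ s, ball x (ρ / 4)) :=
          (measure_biUnion_finset hdisj fun x _ => (isOpen_ball x _).measurableSet).symm
      _ ≤ volumeMeasure d M (ball y (ρ + ρ / 4)) := measure_mono hsub
      _ ≤ ENNReal.ofReal (((ρ + ρ / 4) / (ρ / 4)) ^ d * c) *
            volumeMeasure d M (ball y (ρ / 4)) := hd y _ _ (by linarith) (by linarith) hr2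
      _ ≤ ENNReal.ofReal (5 ^ d * c) * ENNReal.ofReal (a₂ * (ρ / 4) ^ d) := by
          gcongr
          · exact le_of_eq (by field_simp; norm_num)
          · exact (hv y _ (by linarith) hr1).2
      _ = _ := (ENNReal.ofReal_mul (by positivity)).symm
  rw [ENNReal.ofReal_le_ofReal_iff (by positivity)] at key
  have hpos : 0 < (ρ / 4) ^ d := by positivity
  rw [le_div_iff₀ h₁]
  refine le_of_mul_le_mul_right ?_ hpos
  linarith

lemma multiplicity_le_of_disjoint {a₁ a₂ c : ℝ} (hvol : IsVolumeBound d M a₁ a₂)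
    (hdbl : IsDoublingConstant d M c) {ρ : ℝ} (hρ : 0 < ρ)
    (hρr : ENNReal.ofReal ρ < injRadius d M / 6) (X : Finset M)
    (hdisj : (X : Set M).PairwiseDisjoint fun x => ball x (ρ / 4)) :
    (multiplicity (fun x : X => ball (x : M) ρ) : ℝ≥0∞) ≤
      ENNReal.ofReal (5 ^ d * c * a₂ / a₁) := by
  classical
  have hc := hdbl.1
  have h₁ := hvol.1
  have h₂ := hvol.2.1
  -- Rounding the real bound down allows the counts to be compared in ℕ.
  have hle : multiplicity (fun x : X => ball (x : M) ρ) ≤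
      ((⌊5 ^ d * c * a₂ / a₁⌋₊ : ℕ) : ℕ∞) := by
    refine iSup_le fun y => ?_
    have himg : {i : X | y ∈ ball (i : M) ρ}.encard =
        (((X.filter fun x => y ∈ ball x ρ) : Finset M) : Set M).encard := by
      rw [← Subtype.val_injective.encard_image]
      congr 1
      ext x
      simp [and_comm]
    rw [himg, Set.encard_coe_eq_coe_finsetCard, Nat.cast_le]
    refine Nat.le_floor (card_mul_le_of_disjoint hvol hdbl hρ hρr _ y
      (hdisj.subset fun x hx => (Finset.mem_filter.1 hx).1) fun x hx => (Finset.mem_filter.1 hx).2)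
  refine (ENat.toENNReal_mono hle).trans ?_
  rw [ENat.toENNReal_coe, ← ENNReal.ofReal_natCast]
  exact ENNReal.ofReal_le_ofReal (Nat.floor_le (by positivity))

end Multiplicity

end Riem

theorem lemma2p1 (d : ℕ) (M : Type*) [EMetricSpace M] [CompactSpace M]
    [ChartedSpace (EuclideanSpace ℝ (Fin d)) M] [IsManifold (𝓡 d) ∞ M]
    [RiemannianBundle (fun x : M => TangentSpace (𝓡 d) x)]
    [IsContMDiffRiemannianBundle (𝓡 d) ∞ (EuclideanSpace ℝ (Fin d))
      (fun x : M => TangentSpace (𝓡 d) x)]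
    [IsRiemannianManifold (𝓡 d) M]
    [MeasurableSpace M] [BorelSpace M] :
    (∃ a₁ a₂ c : ℝ, Riem.IsVolumeBound d M a₁ a₂ ∧ Riem.IsDoublingConstant d M c) ∧
    ∀ a₁ a₂ c : ℝ, Riem.IsVolumeBound d M a₁ a₂ → Riem.IsDoublingConstant d M c →
      ∀ ρ : ℝ, 0 < ρ → ENNReal.ofReal ρ < Riem.injRadius d M / 6 →
        ∃ X : Finset M,
          (∀ x ∈ X, ∀ y ∈ X, x ≠ y → Disjoint (Riem.ball x (ρ / 4)) (Riem.ball y (ρ / 4))) ∧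
          (⋃ x ∈ X, Riem.ball x (ρ / 2)) = Set.univ ∧
          (Riem.multiplicity (fun x : X => Riem.ball (x : M) ρ) : ℝ≥0∞) ≤
            ENNReal.ofReal (12 ^ d * c * a₂ / a₁) := by
  have : IsContinuousRiemannianBundle (EuclideanSpace ℝ (Fin d))
      (fun x : M => TangentSpace (𝓡 d) x) := by
    obtain ⟨g, hg, hg'⟩ := IsContMDiffRiemannianBundle.exists_contMDiff (IB := 𝓡 d) (n := ∞)
      (F := EuclideanSpace ℝ (Fin d)) (E := fun x : M => TangentSpace (𝓡 d) x)
    exact ⟨g, hg.continuous, hg'⟩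
  refine ⟨?_, fun a₁ a₂ c hvol hdbl ρ hρ hρr => ?_⟩
  · obtain ⟨a₁, a₂, h⟩ := Riem.exists_isVolumeBound (d := d) (M := M)
    exact ⟨a₁, a₂, a₂ / a₁, h, h.isDoublingConstant⟩
  -- The one scale ρ/2 serves twice: maximality gives the cover, separation the disjointness at
  -- radius ρ/4.
  obtain ⟨X, hsep, hcov⟩ := Riem.exists_finset_separated_cover (M := M)
    (ε := ENNReal.ofReal (ρ / 2)) (by simpa using hρ)
  have hdisj : ∀ x ∈ X, ∀ y ∈ X, x ≠ y →
      Disjoint (Riem.ball x (ρ / 4)) (Riem.ball y (ρ / 4)) := fun x hx y hy hxy =>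
    Riem.disjoint_ball_of_le_edist
      ((ENNReal.ofReal_le_ofReal (by linarith)).trans (hsep x hx y hy hxy)) (by positivity)
  refine ⟨X, hdisj, hcov, (Riem.multiplicity_le_of_disjoint hvol hdbl hρ hρr X
    fun x hx y hy hxy => hdisj x hx y hy hxy).trans (ENNReal.ofReal_le_ofReal ?_)⟩
  have hc := hdbl.1
  have h₁ := hvol.1
  have h₂ := hvol.2.1
  gcongr
  norm_num
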